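/- Let $S_n=\sum_{l=1}^{n-1}\csc\frac{\pi l}{n}$, let $H_n=\sum_{k=1}^{n}\frac1k$ be the $n$-th harmonic number, and let $B_k$ be the Bernoulli numbers ($\frac{t}{e^t-1}=\sum_{k\ge0}B_k\frac{t^k}{k!}$). (i) For every integer $N\ge 2$, $$S_n=\frac{2n}{\pi}\Big(H_n-\ln\frac{\pi}{2}\Big)-\frac1\pi+\frac1\pi\sum_{r=1}^{N-1}\frac{B_{2r}}{r\,n^{2r-1}}\Big\{1-\frac{(-1)^{r+1}(2^{2r}-2)\pi^{2r}B_{2r}}{(2r)!}\Big\}+O\big(n^{1-2N}\big),$$ that is, there is a constant $C_N$, depending only on $N$, such that for all integers $n\ge 1$ the two sides, without the $O$-term, differ by at most $C_N\,n^{1-2N}$ in absolute value. (ii) As $n\to\infty$ this is the complete asymptotic expansion of $S_n$ in the sense of Poincaré: if $u_0(n)=\frac{2n}{\pi}(H_n-\ln\frac\pi2)$, $u_1(n)=-\frac1\pi$, and $u_{r+1}(n)=\frac1\pi\,\frac{B_{2r}}{r\,n^{2r-1}}\big\{1-\frac{(-1)^{r+1}(2^{2r}-2)\pi^{2r}B_{2r}}{(2r)!}\big\}$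 for $r\ge1$, then for every $m\ge0$ we have $u_{m+1}(n)=o(u_m(n))$ and $S_n-\sum_{i=0}^{m}u_i(n)=o(u_m(n))$. (iii) The first few terms are $$S_n=\frac{2n}{\pi}\Big(H_n-\ln\frac{\pi}{2}\Big)-\frac1\pi-\frac1n\Big(\frac{\pi}{36}-\frac1{6\pi}\Big)+\frac1{n^3}\Big(\frac{7\pi^3}{21600}-\frac1{60\pi}\Big)-\frac1{n^5}\Big(\frac{31\pi^5}{1905120}-\frac1{126\pi}\Big)+\frac1{n^7}\Big(\frac{127\pi^7}{72576000}-\frac1{120\pi}\Big)+O\big(n^{-9}\big),$$ where the $O$-term is at most $C\,n^{-9}$ in absolute value for all integers $n\ge1$, with an absolute constant $C$. -/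

import Mathlib

noncomputable section

/-- The cosecant `csc x = 1 / sin x`. -/
def csc (x : ℝ) : ℝ := 1 / Real.sin x

/-- `S_n = ∑_{l=1}^{n-1} csc (π l / n)`. -/
def cscSum (n : ℕ) : ℝ :=
  ∑ l ∈ Finset.Ico 1 n, csc (Real.pi * (l : ℝ) / (n : ℝ))

/-- The leading term `(2 n / π) (H_n - ln (π / 2))`, with `H_n` the `n`-th harmonic number. -/
def cscLeading (n : ℕ) : ℝ :=
  2 * (n : ℝ) / Real.pi * ((harmonic n : ℝ) - Real.log (Real.pi / 2))

/-- For `r ≥ 1`, the term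
`B_{2r} / (r n^{2r-1}) * {1 - (-1)^{r+1} (2^{2r} - 2) π^{2r} B_{2r} / (2r)!}`. -/
def cscCorrection (r n : ℕ) : ℝ :=
  (bernoulli (2 * r) : ℝ) / ((r : ℝ) * (n : ℝ) ^ (2 * r - 1)) *
    (1 - (-1) ^ (r + 1) * ((2 : ℝ) ^ (2 * r) - 2) * Real.pi ^ (2 * r) *
      (bernoulli (2 * r) : ℝ) / ((Nat.factorial (2 * r) : ℕ) : ℝ))

/-- The successive terms of the expansion: the leading term, the constant `-1/π`, and then
`1/π` times the corrections with `r = 1, 2, 3, …`. -/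
def cscTerm : ℕ → ℕ → ℝ
  | 0, n => cscLeading n
  | 1, _ => -(1 / Real.pi)
  | r + 2, n => 1 / Real.pi * cscCorrection (r + 1) n

/-- `∑_m u m n` is the complete asymptotic expansion (in the sense of Poincaré) of `f n` as
`n → ∞`: each term is negligible against the preceding one, and the error made by stopping at
any term is negligible against that term. -/
def IsCompleteAsymptoticExpansion (f : ℕ → ℝ) (u : ℕ → ℕ → ℝ) : Prop :=
  (∀ m : ℕ, Asymptotics.IsLittleO Filter.atTop (u (m + 1)) (u m)) ∧
  ∀ m : ℕ, Asymptotics.IsLittleO Filter.atTop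
    (fun n : ℕ => f n - ∑ i ∈ Finset.range (m + 1), u i n) (u m)

end

open Filter Topology Asymptotics

/-! The partial fractions of `π csc (π x)` form an alternating series in `k` of the pairs `cscPair x
k`. Summed over `x = l / n`, the `k`-th pair becomes `2 n` times a block of the harmonic series, so
`π S_n / (2 n) = ∑ (-1)^k harmonicBlock n k` (`hasSum_harmonicBlock`). Terms `2 j + 1` and `2 j + 2`
are grouped to make the series absolutely convergent.

The block `k = 0` is kept exact and gives `H_n`. For `k ≥ 1` the Euler–Maclaurin expansion of the
harmonic numbers is inserted at `k n` and `(k + 1) n`; Euler's constant and `log n` cancel. The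
resulting alternating series have closed forms: the logarithms give `-log (π / 2)` by Wallis'
product, the `1 / k` terms telescope and lead to `-1 / π`, and the even powers give twice an eta
value, minus one. The Euler–Maclaurin errors are `O((k n)^(-2 N))`, hence summable over `k` to
`O(n^(-2 N))`; multiplication by `2 n / π` gives the claimed order.

For the Poincaré expansion, no coefficient may vanish; this follows from `one_lt_twoEta`. -/

/-! ### Euler–Maclaurin expansion of the harmonic numbers -/

theorem integral_bernoulliFun_div_pow_succ (k : ℕ) {m : ℝ} (hm : 0 < m) :
    ∫ t in (0 : ℝ)..1, bernoulliFun k t / (m + t) ^ (k + 1) =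
      bernoulliFun (k + 1) 1 / (k + 1) / (m + 1) ^ (k + 1)
        - bernoulliFun (k + 1) 0 / (k + 1) / m ^ (k + 1)
        + ∫ t in (0 : ℝ)..1, bernoulliFun (k + 1) t / (m + t) ^ (k + 2) := by
  have hpos : ∀ t ∈ Set.uIcc (0 : ℝ) 1, m + t ≠ 0 := fun t ht => by
    rw [Set.uIcc_of_le zero_le_one] at ht
    linarith [ht.1]
  have hk : ((k : ℝ) + 1) ≠ 0 := by positivity
  have hv : ∀ t ∈ Set.uIcc (0 : ℝ) 1,
      HasDerivAt (fun t => ((m + t) ^ (k + 1))⁻¹) (-((k + 1) / (m + t) ^ (k + 2))) t := by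
    intro t ht
    have h0 := hpos t ht
    have h1 : HasDerivAt (fun t => (m + t) ^ (k + 1)) ((k + 1) * (m + t) ^ k) t := by
      simpa using ((hasDerivAt_id t).const_add m).fun_pow (k + 1)
    refine (h1.inv (pow_ne_zero _ h0)).congr_deriv ?_
    field_simp
    ring
  have hc : ∀ j : ℕ, ContinuousOn (fun t => (m + t) ^ j) (Set.uIcc (0 : ℝ) 1) := fun j => by fun_prop
  have hi : IntervalIntegrable (fun t : ℝ => -((k + 1) / (m + t) ^ (k + 2))) MeasureTheory.volume 0 1 :=
    (ContinuousOn.neg (continuousOn_const.div (hc _)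
      fun t ht => pow_ne_zero _ (hpos t ht))).intervalIntegrable
  have key := intervalIntegral.integral_mul_deriv_eq_deriv_mul
    (fun t _ => antideriv_bernoulliFun k t) hv (intervalIntegrable_bernoulliFun k _ _) hi
  have e1 : ∫ t in (0 : ℝ)..1, bernoulliFun (k + 1) t / (k + 1) * -((k + 1) / (m + t) ^ (k + 2))
      = -∫ t in (0 : ℝ)..1, bernoulliFun (k + 1) t / (m + t) ^ (k + 2) := by
    rw [← intervalIntegral.integral_neg]
    congr 1
    ext t
    field_simp
  rw [e1] at key
  simp only [← div_eq_mul_inv, add_zero] at key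
  linarith

/-- The Bernoulli function is bounded on `[0, 1]` and the remaining power integrates exactly. The
bound is left as a difference so that it telescopes when summed over `m`. -/
theorem exists_abs_integral_bernoulliFun_div_pow_le (k : ℕ) (hk : 1 ≤ k) :
    ∃ C : ℝ, 0 ≤ C ∧ ∀ m : ℝ, 0 < m →
      |∫ t in (0 : ℝ)..1, bernoulliFun k t / (m + t) ^ (k + 1)| ≤
        C * (1 / m ^ k - 1 / (m + 1) ^ k) := by
  obtain ⟨C, hC⟩ := (isCompact_Icc (a := (0 : ℝ)) (b := 1)).exists_bound_of_continuousOn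
    (continuous_bernoulliFun k).continuousOn
  have hC0 : 0 ≤ C := (norm_nonneg _).trans (hC 0 (by simp))
  have hk' : (0 : ℝ) < k := by exact_mod_cast hk
  refine ⟨C / k, by positivity, fun m hm => ?_⟩
  have hv : ∀ t ∈ Set.uIcc (0 : ℝ) 1,
      HasDerivAt (fun t => -(C / k) * ((m + t) ^ k)⁻¹) (C / (m + t) ^ (k + 1)) t := by
    intro t ht
    rw [Set.uIcc_of_le zero_le_one] at ht
    have h0 : m + t ≠ 0 := by linarith [ht.1]
    have h1 : HasDerivAt (fun t => (m + t) ^ k) (k * (m + t) ^ (k - 1)) t := by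
      simpa using ((hasDerivAt_id t).const_add m).fun_pow k
    refine ((h1.inv (pow_ne_zero _ h0)).const_mul (-(C / k))).congr_deriv ?_
    obtain ⟨j, rfl⟩ := Nat.exists_eq_add_of_le hk
    simp only [add_tsub_cancel_left]
    field_simp
    ring
  have hi : IntervalIntegrable (fun t : ℝ => C / (m + t) ^ (k + 1)) MeasureTheory.volume 0 1 := by
    refine (continuousOn_const.div (by fun_prop) fun t ht => ?_).intervalIntegrable
    rw [Set.uIcc_of_le zero_le_one] at ht
    have : 0 < m + t := by linarith [ht.1]
    positivity
  have h := intervalIntegral.norm_integral_le_of_norm_le (μ := MeasureTheory.volume)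
    (f := fun t => bernoulliFun k t / (m + t) ^ (k + 1)) zero_le_one
    (MeasureTheory.ae_of_all _ fun t ht => ?_) hi
  · rw [intervalIntegral.integral_eq_sub_of_hasDerivAt hv hi] at h
    refine h.trans (le_of_eq ?_)
    simp only [add_zero]
    ring
  · have : 0 < m + t := by linarith [ht.1]
    rw [norm_div, Real.norm_of_nonneg (r := (m + t) ^ (k + 1)) (by positivity)]
    gcongr
    exact hC t ⟨ht.1.le, ht.2⟩

/-- Repeated integration by parts starting from `∫ 1 / (m + t)`. The first produces the trapezoidal
term; each induction step performs two more, of which the one with odd Bernoulli index has zero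
boundary terms. -/
theorem log_succ_sub_log_eq_bernoulli (M : ℕ) {m : ℝ} (hm : 0 < m) :
    Real.log (m + 1) - Real.log m = (1 / (m + 1) + 1 / m) / 2
      + ∑ r ∈ Finset.Ico 1 (M + 1), (bernoulli (2 * r) : ℝ) / (2 * r) *
          (1 / (m + 1) ^ (2 * r) - 1 / m ^ (2 * r))
      + ∫ t in (0 : ℝ)..1, bernoulliFun (2 * M + 1) t / (m + t) ^ (2 * M + 2) := by
  induction M with
  | zero =>
    have h := integral_bernoulliFun_div_pow_succ 0 hm
    have h0 : ∫ t in (0 : ℝ)..1, bernoulliFun 0 t / (m + t) ^ (0 + 1)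
        = Real.log (m + 1) - Real.log m := by
      rw [intervalIntegral.integral_eq_sub_of_hasDerivAt (f := fun t => Real.log (m + t))]
      · simp
      · intro t ht
        rw [Set.uIcc_of_le zero_le_one] at ht
        have : m + t ≠ 0 := by linarith [ht.1]
        simpa using ((hasDerivAt_id t).const_add m).log this
      · refine ContinuousOn.intervalIntegrable (ContinuousOn.div
          (continuous_bernoulliFun _).continuousOn (by fun_prop) fun t ht => ?_)
        rw [Set.uIcc_of_le zero_le_one] at ht
        have : 0 < m + t := by linarith [ht.1]
        positivity
    rw [h0] at h
    rw [h]
    simp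
    norm_num
    ring
  | succ M ih =>
    rw [ih, Finset.sum_Ico_succ_top (show 1 ≤ M + 1 by omega), integral_bernoulliFun_div_pow_succ (2 * M + 1) hm,
      integral_bernoulliFun_div_pow_succ (2 * M + 1 + 1) hm,
      bernoulliFun_endpoints_eq_of_ne_one (by omega), bernoulliFun_endpoints_eq_of_ne_one (by omega),
      bernoulliFun_eval_zero, bernoulliFun_eval_zero,
      bernoulli_eq_zero_of_odd (n := 2 * M + 1 + 1 + 1) ⟨M + 1, by ring⟩ (by omega)]
    simp only [show 2 * (M + 1) = 2 * M + 1 + 1 by ring]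
    push_cast
    ring

/-- The error of the Euler–Maclaurin expansion of the harmonic numbers. -/
noncomputable def harmonicRemainder (N m : ℕ) : ℝ :=
  (harmonic m : ℝ) - Real.eulerMascheroniConstant - Real.log m - 1 / (2 * m)
    + ∑ r ∈ Finset.Ico 1 N, (bernoulli (2 * r) : ℝ) / (2 * r) * (1 / (m : ℝ) ^ (2 * r))

theorem tendsto_harmonicRemainder (N : ℕ) :
    Tendsto (harmonicRemainder N) atTop (𝓝 0) := by
  have hp : ∀ p : ℕ, p ≠ 0 → Tendsto (fun m : ℕ => 1 / (m : ℝ) ^ p) atTop (𝓝 0) := fun p hp => by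
    simp only [one_div]
    exact ((tendsto_pow_atTop hp).comp tendsto_natCast_atTop_atTop).inv_tendsto_atTop
  have h1 : Tendsto (fun m : ℕ => ∑ r ∈ Finset.Ico 1 N,
      (bernoulli (2 * r) : ℝ) / (2 * r) * (1 / (m : ℝ) ^ (2 * r))) atTop
      (𝓝 (∑ r ∈ Finset.Ico 1 N, (bernoulli (2 * r) : ℝ) / (2 * r) * 0)) :=
    tendsto_finsetSum _ fun r hr => (hp _ (by
      have := (Finset.mem_Ico.1 hr).1
      omega)).const_mul _
  have h2 : Tendsto (fun m : ℕ => 1 / (2 * (m : ℝ))) atTop (𝓝 0) := by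
    simpa [mul_comm, div_eq_mul_inv] using (hp 1 one_ne_zero).div_const 2
  have h := (((Real.tendsto_harmonic_sub_log.sub_const
    Real.eulerMascheroniConstant).sub h2).add h1)
  simp only [mul_zero, Finset.sum_const_zero, sub_self, add_zero] at h
  refine h.congr fun m => ?_
  unfold harmonicRemainder
  ring

theorem harmonicRemainder_succ (M : ℕ) {m : ℕ} (hm : 0 < m) :
    harmonicRemainder (M + 1) (m + 1) = harmonicRemainder (M + 1) m
      - ∫ t in (0 : ℝ)..1, bernoulliFun (2 * M + 1) t / ((m : ℝ) + t) ^ (2 * M + 2) := by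
  have h := log_succ_sub_log_eq_bernoulli M (m := m) (by exact_mod_cast hm)
  unfold harmonicRemainder
  rw [harmonic_succ]
  simp only [mul_sub, Finset.sum_sub_distrib] at h
  push_cast
  have h3 : 1 / (2 * ((m : ℝ) + 1)) = 1 / ((m : ℝ) + 1) / 2 := by
    rw [div_div, mul_comm]
  have h4 : 1 / (2 * (m : ℝ)) = 1 / (m : ℝ) / 2 := by
    rw [div_div, mul_comm]
  rw [h3, h4, ← one_div]
  linarith

theorem exists_abs_harmonicRemainder_le_odd (M : ℕ) :
    ∃ C : ℝ, ∀ m : ℕ, 0 < m → |harmonicRemainder (M + 1) m| ≤ C / (m : ℝ) ^ (2 * M + 1) := by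
  obtain ⟨C, hC0, hC⟩ := exists_abs_integral_bernoulliFun_div_pow_le (2 * M + 1) (by omega)
  refine ⟨C, fun m hm => ?_⟩
  have hstep : ∀ j : ℕ, |harmonicRemainder (M + 1) m - harmonicRemainder (M + 1) (m + j)| ≤
      C * (1 / (m : ℝ) ^ (2 * M + 1) - 1 / ((m + j : ℕ) : ℝ) ^ (2 * M + 1)) := by
    intro j
    induction j with
    | zero => simp
    | succ j ih =>
      have h1 := harmonicRemainder_succ M (m := m + j) (by omega)
      have h2 := hC ((m + j : ℕ) : ℝ) (by exact_mod_cast (by omega : 0 < m + j))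
      rw [show 2 * M + 1 + 1 = 2 * M + 2 by ring] at h2
      rw [← add_assoc, h1, Nat.cast_add_one (m + j)]
      rw [abs_le] at *
      constructor <;> linarith [ih.1, ih.2, h2.1, h2.2]
  -- The remainder vanishes at infinity, so the telescoped bound on differences bounds the remainder
  -- itself.
  have hlim : Tendsto (fun j : ℕ =>
      |harmonicRemainder (M + 1) m - harmonicRemainder (M + 1) (m + j)|) atTop
      (𝓝 |harmonicRemainder (M + 1) m - 0|) :=
    (((tendsto_harmonicRemainder (M + 1)).comp
      (tendsto_add_atTop_nat m)).congr fun j => by simp [add_comm]).const_sub _ |>.abs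
  rw [sub_zero] at hlim
  refine le_of_tendsto' hlim fun j => (hstep j).trans ?_
  rw [div_eq_mul_one_div C]
  gcongr
  simp only [tsub_le_iff_right, le_add_iff_nonneg_right]
  positivity

/-- Going one term further gives an error of order `2 N + 1`; the extra term put back has exact
order `2 N`, one better than the direct estimate. -/
theorem exists_abs_harmonicRemainder_le (N : ℕ) (hN : 1 ≤ N) :
    ∃ C : ℝ, ∀ m : ℕ, 0 < m → |harmonicRemainder N m| ≤ C / (m : ℝ) ^ (2 * N) := by
  obtain ⟨C, hC⟩ := exists_abs_harmonicRemainder_le_odd N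
  refine ⟨|C| + |(bernoulli (2 * N) : ℝ) / (2 * N)|, fun m hm => ?_⟩
  have h1 : harmonicRemainder N m = harmonicRemainder (N + 1) m
      - (bernoulli (2 * N) : ℝ) / (2 * N) * (1 / (m : ℝ) ^ (2 * N)) := by
    unfold harmonicRemainder
    rw [Finset.sum_Ico_succ_top hN]
    ring
  have hm1 : (1 : ℝ) ≤ m := by exact_mod_cast hm
  have h2 : C / (m : ℝ) ^ (2 * N + 1) ≤ |C| / (m : ℝ) ^ (2 * N) := by
    gcongr
    · exact le_abs_self C
    · omega
  rw [h1, add_div]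
  refine (abs_sub _ _).trans (add_le_add ((hC m hm).trans h2) (le_of_eq ?_))
  rw [abs_mul, abs_of_nonneg (a := 1 / (m : ℝ) ^ (2 * N)) (by positivity), mul_one_div]

/-! ### Partial fractions of the cosecant -/

theorem Real.hasSum_pi_mul_cot {x : ℝ} (h0 : 0 < x) (h1 : x < 1) :
    HasSum (fun j : ℕ => 1 / (x - (j + 1)) + 1 / (x + (j + 1)))
      (Real.pi * Real.cot (Real.pi * x) - 1 / x) := by
  have hx : (x : ℂ) ∈ Complex.integerComplement := by
    rintro ⟨k, hk⟩
    have hk' : (k : ℝ) = x := by exact_mod_cast hk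
    have h2 : (0 : ℝ) < k := hk' ▸ h0
    have h3 : (k : ℝ) < 1 := hk' ▸ h1
    have h4 : 0 < k := by exact_mod_cast h2
    have h5 : k < 1 := by exact_mod_cast h3
    omega
  have h := (summable_cotTerm hx).hasSum
  have e : ∑' n : ℕ, cotTerm (x : ℂ) n
      = Real.pi * Complex.cot (Real.pi * x) - 1 / x := (cot_series_rep' hx).symm
  rw [e] at h
  rw [← Complex.hasSum_ofReal]
  convert! h using 1
  · ext j
    simp [cotTerm]
  · simp

/-- The two terms `1 / (x + k) + 1 / (k + 1 - x)` of the partial fraction expansion of the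
cosecant that have the same sign. -/
noncomputable def cscPair (x : ℝ) (k : ℕ) : ℝ := 1 / (x + k) + 1 / (k + 1 - x)

/-- With `θ = π x / 2`, `csc (2 θ) = (cot θ + cot (π / 2 - θ)) / 2`, so the cotangent series at `x /
2` and `(1 - x) / 2` are averaged. -/
theorem hasSum_pi_mul_csc {x : ℝ} (h0 : 0 < x) (h1 : x < 1) :
    HasSum (fun j : ℕ => cscPair x (2 * j + 2) - cscPair x (2 * j + 1))
      (Real.pi * csc (Real.pi * x) - cscPair x 0) := by
  have ha := Real.hasSum_pi_mul_cot (x := x / 2) (by linarith) (by linarith)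
  have hb := Real.hasSum_pi_mul_cot (x := (1 - x) / 2) (by linarith) (by linarith)
  convert! (ha.add hb).div_const 2 using 1
  · ext j
    have hj : (0 : ℝ) ≤ j := j.cast_nonneg
    have n1 : x + (2 * j + 2) ≠ 0 := by linarith
    have n2 : 2 * (j : ℝ) + 2 + 1 - x ≠ 0 := by linarith
    have n3 : x + (2 * j + 1) ≠ 0 := by linarith
    have n4 : 2 * (j : ℝ) + 1 + 1 - x ≠ 0 := by linarith
    have e1 : x / 2 - (j + 1) = -(2 * (j : ℝ) + 1 + 1 - x) / 2 := by ring
    have e2 : x / 2 + (j + 1) = (x + (2 * j + 2)) / 2 := by ring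
    have e3 : (1 - x) / 2 - (j + 1) = -(x + (2 * j + 1)) / 2 := by ring
    have e4 : (1 - x) / 2 + (j + 1) = (2 * (j : ℝ) + 2 + 1 - x) / 2 := by ring
    rw [e1, e2, e3, e4, cscPair, cscPair]
    push_cast
    simp only [one_div, inv_div, neg_div, inv_neg]
    ring
  · have hs : Real.sin (Real.pi * x / 2) ≠ 0 :=
      (Real.sin_pos_of_pos_of_lt_pi (by positivity) (by nlinarith [Real.pi_pos])).ne'
    have hc : Real.cos (Real.pi * x / 2) ≠ 0 :=
      (Real.cos_pos_of_mem_Ioo ⟨by nlinarith [Real.pi_pos], by nlinarith [Real.pi_pos]⟩).ne'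
    have hd : Real.sin (Real.pi * x)
        = 2 * Real.sin (Real.pi * x / 2) * Real.cos (Real.pi * x / 2) := by
      rw [← Real.sin_two_mul]
      congr 1
      ring
    have n5 : 1 - x ≠ 0 := by linarith
    have n6 : x ≠ 0 := h0.ne'
    rw [Real.cot_eq_cos_div_sin, Real.cot_eq_cos_div_sin,
      show Real.pi * ((1 - x) / 2) = Real.pi / 2 - Real.pi * x / 2 by ring,
      Real.cos_pi_div_two_sub, Real.sin_pi_div_two_sub, csc, hd,
      show Real.pi * (x / 2) = Real.pi * x / 2 by ring, cscPair]
    push_cast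
    have hsc := Real.sin_sq_add_cos_sq (Real.pi * x / 2)
    set s := Real.sin (Real.pi * x / 2)
    set c := Real.cos (Real.pi * x / 2)
    have e5 : 1 / (2 * s * c) = (c / s + s / c) / 2 := by
      field_simp
      linarith
    rw [e5, zero_add, add_zero]
    field_simp
    ring

/-! ### The cosecant sum as an alternating series of harmonic blocks -/

/-- The sum of `1 / l` over `k n < l < (k + 1) n`. -/
noncomputable def harmonicBlock (n k : ℕ) : ℝ :=
  (harmonic ((k + 1) * n) : ℝ) - harmonic (k * n) - 1 / ((k + 1) * n)

theorem harmonicBlock_eq_sum {n : ℕ} (hn : 1 ≤ n) (k : ℕ) :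
    harmonicBlock n k = ∑ l ∈ Finset.Ico 1 n, 1 / ((l : ℝ) + k * n) := by
  obtain ⟨m, rfl⟩ := Nat.exists_eq_add_of_le' hn
  have h1 : (harmonic ((k + 1) * (m + 1)) : ℝ) = harmonic (k * (m + 1) + m)
      + 1 / ((k + 1) * ((m : ℝ) + 1)) := by
    rw [show (k + 1) * (m + 1) = k * (m + 1) + m + 1 by ring, harmonic_succ]
    push_cast
    rw [one_div]
    congr 2
    ring
  have h2 : ∀ a b : ℕ, (harmonic (a + b) : ℝ) - harmonic a
      = ∑ l ∈ Finset.Ico 1 (b + 1), 1 / ((l : ℝ) + a) := by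
    intro a b
    induction b with
    | zero => simp
    | succ b ih =>
      rw [Finset.sum_Ico_succ_top (by omega), ← ih, ← add_assoc, harmonic_succ]
      push_cast
      rw [one_div]
      ring_nf
  have h3 := h2 (k * (m + 1)) m
  unfold harmonicBlock
  rw [h1]
  push_cast at h3 ⊢
  rw [← h3]
  ring

theorem sum_cscPair {n : ℕ} (hn : 1 ≤ n) (k : ℕ) :
    ∑ l ∈ Finset.Ico 1 n, cscPair ((l : ℝ) / n) k = 2 * n * harmonicBlock n k := by
  have hn0 : (n : ℝ) ≠ 0 := by positivity
  have h1 : ∑ l ∈ Finset.Ico 1 n, 1 / ((k : ℝ) + 1 - (l : ℝ) / n)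
      = ∑ l ∈ Finset.Ico 1 n, 1 / ((l : ℝ) / n + k) := by
    -- The reflection `l ↦ n - l` exchanges the two fractions of the pair.
    have hr := Finset.sum_Ico_reflect (fun l : ℕ => 1 / ((k : ℝ) + 1 - (l : ℝ) / n)) 1 (Nat.le_succ n)
    simp only [add_tsub_cancel_left, add_tsub_cancel_right] at hr
    rw [← hr]
    refine Finset.sum_congr rfl fun l hl => ?_
    rw [Finset.mem_Ico] at hl
    rw [Nat.cast_sub hl.2.le]
    congr 1
    field_simp
    ring
  simp only [cscPair]
  rw [Finset.sum_add_distrib, h1, harmonicBlock_eq_sum hn, ← two_mul, mul_assoc,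
    Finset.mul_sum (a := (n : ℝ))]
  congr 1
  refine Finset.sum_congr rfl fun l hl => ?_
  have hl0 : (1 : ℝ) ≤ l := by exact_mod_cast (Finset.mem_Ico.1 hl).1
  have : (l : ℝ) + k * n ≠ 0 := by positivity
  field_simp

theorem hasSum_harmonicBlock {n : ℕ} (hn : 1 ≤ n) :
    HasSum (fun j : ℕ => harmonicBlock n (2 * j + 2) - harmonicBlock n (2 * j + 1))
      (Real.pi / (2 * n) * cscSum n - harmonicBlock n 0) := by
  have hn0 : (0 : ℝ) < n := by exact_mod_cast hn
  have h : HasSum (fun j : ℕ => ∑ l ∈ Finset.Ico 1 n,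
      (cscPair ((l : ℝ) / n) (2 * j + 2) - cscPair ((l : ℝ) / n) (2 * j + 1)))
      (∑ l ∈ Finset.Ico 1 n, (Real.pi * csc (Real.pi * ((l : ℝ) / n)) - cscPair ((l : ℝ) / n) 0)) :=
    hasSum_sum fun l hl => by
      have h1 : (1 : ℝ) ≤ l := by exact_mod_cast (Finset.mem_Ico.1 hl).1
      have h2 : (l : ℝ) < n := by exact_mod_cast (Finset.mem_Ico.1 hl).2
      exact hasSum_pi_mul_csc (by positivity) (by rwa [div_lt_one hn0])
  simp only [Finset.sum_sub_distrib, sum_cscPair hn, ← Finset.mul_sum] at h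
  convert! h.div_const (2 * (n : ℝ)) using 1
  · ext j
    field_simp
  · simp only [cscSum, mul_div_assoc]
    field_simp

/-! ### Closed forms of the alternating series -/

theorem hasSum_log_second_difference :
    HasSum (fun j : ℕ => (Real.log (2 * j + 3) - Real.log (2 * j + 2))
      - (Real.log (2 * j + 2) - Real.log (2 * j + 1))) (-Real.log (Real.pi / 2)) := by
  have hterm : ∀ j : ℕ, Real.log ((2 * (j : ℝ) + 2) / (2 * j + 1) * ((2 * j + 2) / (2 * j + 3)))
      = -((Real.log (2 * j + 3) - Real.log (2 * j + 2))
      - (Real.log (2 * j + 2) - Real.log (2 * j + 1))) := by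
    intro j
    rw [Real.log_mul (by positivity) (by positivity), Real.log_div (by positivity) (by positivity),
      Real.log_div (by positivity) (by positivity)]
    ring
  have h : HasSum (fun j : ℕ =>
      Real.log ((2 * (j : ℝ) + 2) / (2 * j + 1) * ((2 * j + 2) / (2 * j + 3))))
      (Real.log (Real.pi / 2)) := by
    -- Every Wallis factor is at least `1`, so convergence of the partial products suffices.
    rw [hasSum_iff_tendsto_nat_of_nonneg]
    · refine ((Real.continuousAt_log (by positivity)).tendsto.comp
        Real.tendsto_prod_pi_div_two).congr fun k => ?_
      rw [Function.comp, Real.log_prod fun i _ => by positivity]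
    · intro j
      refine Real.log_nonneg ?_
      rw [div_mul_div_comm, one_le_div (by positivity)]
      nlinarith
  simp only [hterm] at h
  simpa using h.neg

theorem hasSum_inv_odd_telescope :
    HasSum (fun j : ℕ => (1 / (2 * (j : ℝ) + 3) + 1 / (2 * j + 2))
      - (1 / (2 * j + 2) + 1 / (2 * j + 1))) (-1) := by
  have h : HasSum (fun j : ℕ => 1 / (2 * (j : ℝ) + 1) - 1 / (2 * j + 3)) 1 := by
    rw [hasSum_iff_tendsto_nat_of_nonneg]
    · have hs : ∀ k : ℕ, ∑ j ∈ Finset.range k, (1 / (2 * (j : ℝ) + 1) - 1 / (2 * j + 3))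
          = 1 - 1 / (2 * (k : ℝ) + 1) := by
        intro k
        induction k with
        | zero => simp
        | succ k ih =>
          rw [Finset.sum_range_succ, ih]
          push_cast
          ring
      simp only [hs]
      have hlim : Tendsto (fun k : ℕ => 1 / (2 * (k : ℝ) + 1)) atTop (𝓝 0) := by
        simp only [one_div]
        exact (tendsto_atTop_add_const_right _ 1
          (tendsto_natCast_atTop_atTop.const_mul_atTop two_pos)).inv_tendsto_atTop
      simpa using hlim.const_sub 1
    · intro j
      rw [sub_nonneg]
      gcongr
      norm_num
  convert! h.neg using 1
  ext j
  ring

/-- Twice the value at `2 r` of the Dirichlet eta function. -/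
noncomputable def twoEta (r : ℕ) : ℝ :=
  (-1) ^ (r + 1) * ((2 : ℝ) ^ (2 * r) - 2) * Real.pi ^ (2 * r) *
    (bernoulli (2 * r) : ℝ) / ((Nat.factorial (2 * r) : ℕ) : ℝ)

theorem twoEta_eq_mul_zeta {r : ℕ} (hr : r ≠ 0) {z : ℝ}
    (hz : HasSum (fun n : ℕ => 1 / (n : ℝ) ^ (2 * r)) z) :
    twoEta r = 2 * (z - 2 * (z / 2 ^ (2 * r))) := by
  rw [hz.unique (hasSum_zeta_nat hr), twoEta]
  have h : (2 : ℝ) ^ (2 * r) = 2 * 2 ^ (2 * r - 1) := by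
    rw [← pow_succ']
    congr 1
    omega
  rw [h]
  field_simp

theorem hasSum_pow_second_difference {r : ℕ} (hr : r ≠ 0) :
    HasSum (fun j : ℕ => (1 / (2 * (j : ℝ) + 3) ^ (2 * r) - 1 / (2 * j + 2) ^ (2 * r))
      - (1 / (2 * j + 2) ^ (2 * r) - 1 / (2 * j + 1) ^ (2 * r))) (twoEta r - 1) := by
  have hz := hasSum_zeta_nat hr
  set z := (-1 : ℝ) ^ (r + 1) * (2 : ℝ) ^ (2 * r - 1) * Real.pi ^ (2 * r) *
        bernoulli (2 * r) / (2 * r).factorial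
  have he : HasSum (fun j : ℕ => 1 / ((2 * j : ℕ) : ℝ) ^ (2 * r)) (z / 2 ^ (2 * r)) := by
    convert! hz.div_const (2 ^ (2 * r)) using 1
    ext j
    push_cast
    rw [mul_pow, div_div, mul_comm]
  have hodd : Summable fun j : ℕ => 1 / ((2 * j + 1 : ℕ) : ℝ) ^ (2 * r) :=
    hz.summable.comp_injective (i := fun j : ℕ => 2 * j + 1) fun a b h => by
      simpa using h
  have ho : HasSum (fun j : ℕ => 1 / ((2 * j + 1 : ℕ) : ℝ) ^ (2 * r)) (z - z / 2 ^ (2 * r)) := by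
    have h := hz.unique (he.even_add_odd (f := fun n : ℕ => 1 / (n : ℝ) ^ (2 * r)) hodd.hasSum)
    rw [← eq_sub_iff_add_eq'.2 h.symm]
    exact hodd.hasSum
  -- The dropped even term is `1 / 0 ^ (2 * r) = 0`; the dropped odd term is `1`, the source of the
  -- `-1`.
  have he' := (hasSum_nat_add_iff' 1).2 he
  have ho' := (hasSum_nat_add_iff' 1).2 ho
  convert! (ho'.sub he').sub (he'.sub ho) using 1
  · ext j
    push_cast
    ring_nf
  · rw [twoEta_eq_mul_zeta hr hz]
    simp [hr]
    ring

/-- Since `2 ^ (2 * r) ≥ 4`, `twoEta r` is at least the zeta value, which exceeds `1`. -/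
theorem one_lt_twoEta {r : ℕ} (hr : 1 ≤ r) : 1 < twoEta r := by
  have hz := hasSum_zeta_nat (k := r) (by omega)
  rw [twoEta_eq_mul_zeta (by omega) hz]
  set z := (-1 : ℝ) ^ (r + 1) * (2 : ℝ) ^ (2 * r - 1) * Real.pi ^ (2 * r) *
        bernoulli (2 * r) / (2 * r).factorial
  have h1 : 1 < z := by
    have h := sum_le_hasSum (Finset.range 3) (fun n _ => by positivity) hz
    simp only [Finset.sum_range_succ, Finset.sum_range_zero] at h
    have h2 : (0 : ℝ) < (2 ^ (2 * r))⁻¹ := by positivity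
    have h3 : (0 : ℝ) ≤ (0 ^ (2 * r))⁻¹ := by positivity
    norm_num at h
    linarith
  have h4 : (4 : ℝ) ≤ 2 ^ (2 * r) := by
    calc (4 : ℝ) = 2 ^ 2 := by norm_num
      _ ≤ 2 ^ (2 * r) := pow_le_pow_right₀ (by norm_num) (by omega)
  have h5 : z / 2 ^ (2 * r) ≤ z / 4 := by gcongr
  linarith

/-! ### Assembling the expansion and bounding its error -/

theorem harmonicBlock_eq_expansion (N : ℕ) {n k : ℕ} (hn : 1 ≤ n) (hk : 1 ≤ k) :
    harmonicBlock n k = (Real.log (k + 1) - Real.log k)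
      - 1 / (2 * n) * (1 / ((k : ℝ) + 1) + 1 / k)
      - ∑ r ∈ Finset.Ico 1 N, (bernoulli (2 * r) : ℝ) / (2 * r * (n : ℝ) ^ (2 * r)) *
          (1 / ((k : ℝ) + 1) ^ (2 * r) - 1 / (k : ℝ) ^ (2 * r))
      + (harmonicRemainder N ((k + 1) * n) - harmonicRemainder N (k * n)) := by
  have hn0 : (n : ℝ) ≠ 0 := by positivity
  have hk0 : (k : ℝ) ≠ 0 := by positivity
  have hk1 : (k : ℝ) + 1 ≠ 0 := by positivity
  have hs : ∑ r ∈ Finset.Ico 1 N, (bernoulli (2 * r) : ℝ) / (2 * r * (n : ℝ) ^ (2 * r)) *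
          (1 / ((k : ℝ) + 1) ^ (2 * r) - 1 / (k : ℝ) ^ (2 * r))
      = ∑ r ∈ Finset.Ico 1 N, (bernoulli (2 * r) : ℝ) / (2 * r) *
            (1 / (((k + 1) * n : ℕ) : ℝ) ^ (2 * r))
        - ∑ r ∈ Finset.Ico 1 N, (bernoulli (2 * r) : ℝ) / (2 * r) *
            (1 / ((k * n : ℕ) : ℝ) ^ (2 * r)) := by
    rw [← Finset.sum_sub_distrib]
    refine Finset.sum_congr rfl fun r _ => ?_
    push_cast
    simp only [mul_pow, mul_inv, div_eq_mul_inv]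
    ring
  rw [hs, harmonicBlock, harmonicRemainder, harmonicRemainder]
  push_cast
  rw [Real.log_mul hk1 hn0, Real.log_mul hk0 hn0]
  field_simp
  ring

theorem exists_abs_tsum_harmonicRemainder_le {N : ℕ} (hN : 1 ≤ N) :
    ∃ C : ℝ, ∀ n : ℕ, 1 ≤ n → ∀ s : ℝ,
      HasSum (fun j : ℕ =>
        (harmonicRemainder N ((2 * j + 3) * n) - harmonicRemainder N ((2 * j + 2) * n))
        - (harmonicRemainder N ((2 * j + 2) * n) - harmonicRemainder N ((2 * j + 1) * n))) s →
      |s| ≤ C / (n : ℝ) ^ (2 * N) := by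
  obtain ⟨C, hC⟩ := exists_abs_harmonicRemainder_le N hN
  have hC0 : 0 ≤ C := by simpa using (abs_nonneg _).trans (hC 1 one_pos)
  have hz := (hasSum_nat_add_iff' 1).2 (hasSum_zeta_nat (k := N) (by omega))
  set z := (-1 : ℝ) ^ (N + 1) * (2 : ℝ) ^ (2 * N - 1) * Real.pi ^ (2 * N) *
        bernoulli (2 * N) / (2 * N).factorial -
        ∑ i ∈ Finset.range 1, 1 / (i : ℝ) ^ (2 * N)
  -- Each summand contains four remainders, the middle one counted twice, and all arguments are at
  -- least `(j + 1) n`; `z` is the sum of `1 / (j + 1) ^ (2 * N)`.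
  refine ⟨4 * C * z, fun n hn s hs => ?_⟩
  have hn0 : (0 : ℝ) < n := by exact_mod_cast hn
  have hb : ∀ j i : ℕ, j + 1 ≤ i → |harmonicRemainder N (i * n)|
      ≤ C / (n : ℝ) ^ (2 * N) * (1 / ((j + 1 : ℕ) : ℝ) ^ (2 * N)) := by
    intro j i hi
    have hi0 : 0 < i := by omega
    refine (hC _ (by positivity)).trans ?_
    push_cast
    rw [div_mul_div_comm, mul_one, mul_comm (i : ℝ), mul_pow]
    gcongr
    exact_mod_cast hi
  have hfin := (hz.mul_left (4 * (C / (n : ℝ) ^ (2 * N))))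
  rw [show 4 * C * z / (n : ℝ) ^ (2 * N) = 4 * (C / (n : ℝ) ^ (2 * N)) * z by ring,
    ← hs.tsum_eq, ← Real.norm_eq_abs]
  refine tsum_of_norm_bounded hfin fun j => ?_
  have h3 := hb j (2 * j + 3) (by omega)
  have h2 := hb j (2 * j + 2) (by omega)
  have h1 := hb j (2 * j + 1) (by omega)
  rw [abs_le] at h1 h2 h3
  rw [Real.norm_eq_abs, abs_le]
  constructor <;> linarith [h1.1, h1.2, h2.1, h2.2, h3.1, h3.2]

/-- The error of the expansion of `cscSum` cut before the correction with index `N`. -/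
noncomputable def cscRemainder (N n : ℕ) : ℝ :=
  cscSum n - (cscLeading n - 1 / Real.pi + 1 / Real.pi * ∑ r ∈ Finset.Ico 1 N, cscCorrection r n)

theorem hasSum_cscRemainder (N : ℕ) {n : ℕ} (hn : 1 ≤ n) :
    HasSum (fun j : ℕ =>
      (harmonicRemainder N ((2 * j + 3) * n) - harmonicRemainder N ((2 * j + 2) * n))
      - (harmonicRemainder N ((2 * j + 2) * n) - harmonicRemainder N ((2 * j + 1) * n)))
      (Real.pi / (2 * n) * cscRemainder N n) := by
  have hn0 : (n : ℝ) ≠ 0 := by positivity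
  have hP : HasSum (fun j : ℕ => ∑ r ∈ Finset.Ico 1 N,
      (bernoulli (2 * r) : ℝ) / (2 * r * (n : ℝ) ^ (2 * r)) *
      ((1 / (2 * (j : ℝ) + 3) ^ (2 * r) - 1 / (2 * j + 2) ^ (2 * r))
      - (1 / (2 * j + 2) ^ (2 * r) - 1 / (2 * j + 1) ^ (2 * r))))
      (∑ r ∈ Finset.Ico 1 N,
        (bernoulli (2 * r) : ℝ) / (2 * r * (n : ℝ) ^ (2 * r)) * (twoEta r - 1)) :=
    hasSum_sum fun r hr => (hasSum_pow_second_difference (by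
      have := (Finset.mem_Ico.1 hr).1
      omega)).mul_left _
  convert! (((hasSum_harmonicBlock hn).sub hasSum_log_second_difference).add
    (hasSum_inv_odd_telescope.mul_left (1 / (2 * (n : ℝ))))).add hP using 1
  · ext j
    rw [harmonicBlock_eq_expansion N hn (by omega), harmonicBlock_eq_expansion N hn (by omega)]
    simp only [mul_sub, Finset.sum_sub_distrib]
    push_cast
    simp only [show (2 * (j : ℝ) + 2 + 1) = 2 * j + 3 by ring,
      show (2 * (j : ℝ) + 1 + 1) = 2 * j + 2 by ring,
      show 2 * j + 2 + 1 = 2 * j + 3 by ring, show 2 * j + 1 + 1 = 2 * j + 2 by ring]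
    ring
  · have hs : ∑ r ∈ Finset.Ico 1 N,
        (bernoulli (2 * r) : ℝ) / (2 * r * (n : ℝ) ^ (2 * r)) * (twoEta r - 1)
        = -(1 / (2 * n)) * ∑ r ∈ Finset.Ico 1 N, cscCorrection r n := by
      rw [Finset.mul_sum]
      refine Finset.sum_congr rfl fun r hr => ?_
      have hr1 := (Finset.mem_Ico.1 hr).1
      have hr0 : (r : ℝ) ≠ 0 := by positivity
      have hp : (n : ℝ) ^ (2 * r) = n ^ (2 * r - 1) * n := by
        rw [← pow_succ]
        congr 1
        omega
      rw [hp, cscCorrection, ← twoEta]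
      field_simp
      ring
    rw [hs, cscRemainder, cscLeading, harmonicBlock]
    simp only [zero_add, one_mul, zero_mul, harmonic_zero, Rat.cast_zero, Nat.cast_zero]
    field_simp
    ring

theorem exists_abs_cscRemainder_le {N : ℕ} (hN : 1 ≤ N) :
    ∃ C : ℝ, ∀ n : ℕ, 1 ≤ n → |cscRemainder N n| ≤ C / (n : ℝ) ^ (2 * N - 1) := by
  obtain ⟨C, hC⟩ := exists_abs_tsum_harmonicRemainder_le hN
  refine ⟨2 * C / Real.pi, fun n hn => ?_⟩
  have hn0 : (0 : ℝ) < n := by exact_mod_cast hn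
  have h := hC n hn _ (hasSum_cscRemainder N hn)
  have hp : (n : ℝ) ^ (2 * N) = n ^ (2 * N - 1) * n := by
    rw [← pow_succ]
    congr 1
    omega
  rw [abs_mul, abs_of_pos (by positivity), hp, ← le_div_iff₀' (by positivity)] at h
  refine h.trans (le_of_eq ?_)
  field_simp

/-! ### Explicit first terms -/

theorem bernoulli_four : bernoulli 4 = -1 / 30 := by
  rw [bernoulli_eq_bernoulli'_of_ne_one (by norm_num), bernoulli'_four]

theorem bernoulli_six : bernoulli 6 = 1 / 42 := by
  have h := sum_bernoulli 7
  have h3 : bernoulli 3 = 0 := bernoulli_eq_zero_of_odd (by decide) (by norm_num)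
  have h5 : bernoulli 5 = 0 := bernoulli_eq_zero_of_odd (by decide) (by norm_num)
  simp only [Finset.sum_range_succ, Finset.sum_range_zero, bernoulli_zero, bernoulli_one,
    bernoulli_two, bernoulli_four, h3, h5] at h
  norm_num [Nat.choose] at h
  linarith

theorem bernoulli_eight : bernoulli 8 = -1 / 30 := by
  have h := sum_bernoulli 9
  have h3 : bernoulli 3 = 0 := bernoulli_eq_zero_of_odd (by decide) (by norm_num)
  have h5 : bernoulli 5 = 0 := bernoulli_eq_zero_of_odd (by decide) (by norm_num)
  have h7 : bernoulli 7 = 0 := bernoulli_eq_zero_of_odd (by decide) (by norm_num)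
  simp only [Finset.sum_range_succ, Finset.sum_range_zero, bernoulli_zero, bernoulli_one,
    bernoulli_two, bernoulli_four, bernoulli_six, h3, h5, h7] at h
  norm_num [Nat.choose] at h
  linarith

theorem exists_abs_cscRemainder_le_zpow {N : ℕ} (hN : 1 ≤ N) :
    ∃ C : ℝ, ∀ n : ℕ, 1 ≤ n → |cscRemainder N n| ≤ C * (n : ℝ) ^ (1 - 2 * (N : ℤ)) := by
  obtain ⟨C, hC⟩ := exists_abs_cscRemainder_le hN
  refine ⟨C, fun n hn => (hC n hn).trans (le_of_eq ?_)⟩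
  rw [show 1 - 2 * (N : ℤ) = -((2 * N - 1 : ℕ) : ℤ) by omega, zpow_neg, zpow_natCast,
    div_eq_mul_inv]

theorem cscRemainder_five {n : ℕ} (hn : 1 ≤ n) :
    cscRemainder 5 n = cscSum n
      - (2 * (n : ℝ) / Real.pi * ((harmonic n : ℝ) - Real.log (Real.pi / 2))
          - 1 / Real.pi
          - 1 / (n : ℝ) * (Real.pi / 36 - 1 / (6 * Real.pi))
          + 1 / (n : ℝ) ^ 3 * (7 * Real.pi ^ 3 / 21600 - 1 / (60 * Real.pi))
          - 1 / (n : ℝ) ^ 5 * (31 * Real.pi ^ 5 / 1905120 - 1 / (126 * Real.pi))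
          + 1 / (n : ℝ) ^ 7 * (127 * Real.pi ^ 7 / 72576000 - 1 / (120 * Real.pi))) := by
  have hn0 : (n : ℝ) ≠ 0 := by positivity
  have hpi := Real.pi_ne_zero
  have h1 : 1 / Real.pi * cscCorrection 1 n
      = -(1 / (n : ℝ) * (Real.pi / 36 - 1 / (6 * Real.pi))) := by
    norm_num [cscCorrection, bernoulli_two, Nat.factorial]
    field_simp
    ring
  have h2 : 1 / Real.pi * cscCorrection 2 n
      = 1 / (n : ℝ) ^ 3 * (7 * Real.pi ^ 3 / 21600 - 1 / (60 * Real.pi)) := by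
    norm_num [cscCorrection, bernoulli_four, Nat.factorial]
    field_simp
    ring
  have h3 : 1 / Real.pi * cscCorrection 3 n
      = -(1 / (n : ℝ) ^ 5 * (31 * Real.pi ^ 5 / 1905120 - 1 / (126 * Real.pi))) := by
    norm_num [cscCorrection, bernoulli_six, Nat.factorial]
    field_simp
    ring
  have h4 : 1 / Real.pi * cscCorrection 4 n
      = 1 / (n : ℝ) ^ 7 * (127 * Real.pi ^ 7 / 72576000 - 1 / (120 * Real.pi)) := by
    norm_num [cscCorrection, bernoulli_eight, Nat.factorial]
    field_simp
    ring
  have hs : Finset.Ico 1 5 = {1, 2, 3, 4} := by decide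
  rw [cscRemainder, hs, Finset.mul_sum, Finset.sum_insert (by decide), Finset.sum_insert (by decide),
    Finset.sum_insert (by decide), Finset.sum_singleton, h1, h2, h3, h4, cscLeading]
  ring

/-! ### The expansion in the sense of Poincaré -/

theorem sum_cscTerm (m n : ℕ) :
    cscSum n - ∑ i ∈ Finset.range (m + 1 + 1), cscTerm i n = cscRemainder (m + 1) n := by
  have h : ∑ i ∈ Finset.range (m + 1 + 1), cscTerm i n
      = cscLeading n - 1 / Real.pi + 1 / Real.pi * ∑ r ∈ Finset.Ico 1 (m + 1), cscCorrection r n := by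
    induction m with
    | zero => simp [Finset.sum_range_succ, cscTerm, sub_eq_add_neg]
    | succ m ih =>
      rw [Finset.sum_range_succ, ih, Finset.sum_Ico_succ_top (show 1 ≤ m + 1 by omega), cscTerm]
      ring
  rw [h, cscRemainder]

theorem tendsto_cscLeading : Tendsto cscLeading atTop atTop := by
  have h1 : Tendsto (fun n : ℕ => (harmonic n : ℝ) - Real.log (Real.pi / 2)) atTop atTop := by
    refine tendsto_atTop_add_const_right _ _ ?_
    refine tendsto_atTop_mono (fun n => log_add_one_le_harmonic n) ?_
    exact Real.tendsto_log_atTop.comp (tendsto_natCast_atTop_atTop.comp (tendsto_add_atTop_nat 1))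
  have h2 : Tendsto (fun n : ℕ => 2 * (n : ℝ) / Real.pi) atTop atTop :=
    (tendsto_natCast_atTop_atTop.const_mul_atTop two_pos).atTop_div_const Real.pi_pos
  exact h2.atTop_mul_atTop₀ h1

theorem isLittleO_div_pow {f : ℕ → ℝ} {C a : ℝ} {p q : ℕ} (ha : a ≠ 0) (hpq : q < p)
    (hf : ∀ n : ℕ, 1 ≤ n → |f n| ≤ C / (n : ℝ) ^ p) :
    IsLittleO atTop f (fun n : ℕ => a / (n : ℝ) ^ q) := by
  have h1 : IsBigO atTop f (fun n : ℕ => 1 / (n : ℝ) ^ p) := by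
    refine IsBigO.of_bound C ?_
    filter_upwards [eventually_ge_atTop 1] with n hn
    rw [Real.norm_eq_abs, Real.norm_of_nonneg (by positivity), mul_one_div]
    exact hf n hn
  refine h1.trans_isLittleO ?_
  have h2 : IsLittleO atTop (fun n : ℕ => 1 / (n : ℝ) ^ p) (fun n : ℕ => 1 / (n : ℝ) ^ q) := by
    have h := ((isLittleO_pow_pow_atTop_of_lt (𝕜 := ℝ) hpq).comp_tendsto
      tendsto_natCast_atTop_atTop).inv_rev (by
        filter_upwards [eventually_ge_atTop 1] with n hn h0
        simp only [Function.comp] at h0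
        have : (0 : ℝ) < (n : ℝ) ^ q := by positivity
        exact absurd h0 this.ne')
    simpa only [one_div, Function.comp_apply] using h
  refine h2.trans_isBigO (IsBigO.of_bound (1 / |a|) (Eventually.of_forall fun n => le_of_eq ?_))
  rw [norm_div, norm_div, norm_one, Real.norm_eq_abs a]
  have : |a| ≠ 0 := abs_ne_zero.2 ha
  field_simp

/-- At `m = 0` the truncated exponent `2 * m - 1` is `0`, which fits the constant term. The
coefficient is nonzero because `1 < twoEta` excludes both a vanishing brace and a vanishing
Bernoulli number. -/
theorem exists_cscTerm_eq_div_pow (m : ℕ) :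
    ∃ a : ℝ, a ≠ 0 ∧ cscTerm (m + 1) = fun n : ℕ => a / (n : ℝ) ^ (2 * m - 1) := by
  cases m with
  | zero =>
    refine ⟨-(1 / Real.pi), neg_ne_zero.2 (one_div_ne_zero Real.pi_ne_zero), ?_⟩
    ext n
    simp [cscTerm]
  | succ r =>
    have heta := one_lt_twoEta (r := r + 1) (by omega)
    have hB : (bernoulli (2 * (r + 1)) : ℝ) ≠ 0 := by
      intro h
      rw [twoEta, h] at heta
      norm_num at heta
    have hr : ((r + 1 : ℕ) : ℝ) ≠ 0 := by positivity
    refine ⟨1 / Real.pi * ((bernoulli (2 * (r + 1)) : ℝ) / (r + 1 : ℕ) * (1 - twoEta (r + 1))),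
      mul_ne_zero (one_div_ne_zero Real.pi_ne_zero)
        (mul_ne_zero (div_ne_zero hB hr) (by linarith)), ?_⟩
    ext n
    rw [cscTerm, cscCorrection, ← twoEta]
    simp only [div_eq_mul_inv, mul_inv]
    ring

theorem isCompleteAsymptoticExpansion_cscSum :
    IsCompleteAsymptoticExpansion cscSum cscTerm := by
  have hlead : ∀ c : ℝ, IsLittleO atTop (fun _ : ℕ => c) (cscTerm 0) := fun c =>
    isLittleO_const_left.2 (Or.inr (tendsto_norm_atTop_atTop.comp tendsto_cscLeading))
  constructor
  · intro m
    obtain ⟨a, ha, hta⟩ := exists_cscTerm_eq_div_pow m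
    cases m with
    | zero => exact hlead (-(1 / Real.pi))
    | succ m =>
      obtain ⟨b, hb, htb⟩ := exists_cscTerm_eq_div_pow m
      rw [hta, htb]
      refine isLittleO_div_pow (C := |a|) (p := 2 * (m + 1) - 1) hb (by omega) fun n hn => ?_
      rw [abs_div, abs_of_nonneg (a := (n : ℝ) ^ (2 * (m + 1) - 1)) (by positivity)]
  · intro m
    cases m with
    | zero =>
      obtain ⟨C, hC⟩ := exists_abs_cscRemainder_le (N := 1) le_rfl
      -- The error bounds are available only once the constant term is subtracted, so it is added
      -- back; it is negligible since the leading term tends to infinity.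
      have h : (fun n : ℕ => cscSum n - ∑ i ∈ Finset.range (0 + 1), cscTerm i n)
          = fun n : ℕ => cscRemainder 1 n + cscTerm 1 n := by
        ext n
        rw [← sum_cscTerm 0 n, Finset.sum_range_succ _ (0 + 1)]
        ring
      rw [h]
      refine IsLittleO.add ?_ (hlead (-(1 / Real.pi)))
      refine IsLittleO.trans ?_ (hlead 1)
      simpa using isLittleO_div_pow (q := 0) one_ne_zero (by norm_num) hC
    | succ m =>
      obtain ⟨b, hb, htb⟩ := exists_cscTerm_eq_div_pow m
      obtain ⟨C, hC⟩ := exists_abs_cscRemainder_le (N := m + 1) (by omega)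
      simp only [sum_cscTerm]
      rw [htb]
      exact isLittleO_div_pow hb (by omega) hC

theorem mainTheorem3 :
    (∀ N : ℕ, 2 ≤ N → ∃ C : ℝ, ∀ n : ℕ, 1 ≤ n →
      |cscSum n - (2 * (n : ℝ) / Real.pi * ((harmonic n : ℝ) - Real.log (Real.pi / 2))
          - 1 / Real.pi
          + 1 / Real.pi * ∑ r ∈ Finset.Ico 1 N,
              (bernoulli (2 * r) : ℝ) / ((r : ℝ) * (n : ℝ) ^ (2 * r - 1)) *
                (1 - (-1) ^ (r + 1) * ((2 : ℝ) ^ (2 * r) - 2) * Real.pi ^ (2 * r) *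
                  (bernoulli (2 * r) : ℝ) / ((Nat.factorial (2 * r) : ℕ) : ℝ)))|
        ≤ C * (n : ℝ) ^ (1 - 2 * (N : ℤ))) ∧
    IsCompleteAsymptoticExpansion cscSum cscTerm ∧
    (∃ C : ℝ, ∀ n : ℕ, 1 ≤ n →
      |cscSum n - (2 * (n : ℝ) / Real.pi * ((harmonic n : ℝ) - Real.log (Real.pi / 2))
          - 1 / Real.pi
          - 1 / (n : ℝ) * (Real.pi / 36 - 1 / (6 * Real.pi))
          + 1 / (n : ℝ) ^ 3 * (7 * Real.pi ^ 3 / 21600 - 1 / (60 * Real.pi))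
          - 1 / (n : ℝ) ^ 5 * (31 * Real.pi ^ 5 / 1905120 - 1 / (126 * Real.pi))
          + 1 / (n : ℝ) ^ 7 * (127 * Real.pi ^ 7 / 72576000 - 1 / (120 * Real.pi)))|
        ≤ C * (n : ℝ) ^ (-9 : ℤ)) := by
  refine ⟨fun N hN => exists_abs_cscRemainder_le_zpow (by omega),
    isCompleteAsymptoticExpansion_cscSum, ?_⟩
  -- Four corrections correspond to `N = 5`, and `1 - 2 * 5 = -9`.
  obtain ⟨C, hC⟩ := exists_abs_cscRemainder_le_zpow (N := 5) (by norm_num)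
  refine ⟨C, fun n hn => ?_⟩
  rw [← cscRemainder_five hn]
  simpa using hC n hn
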